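/- Let $X$ and $Y$ be complex Banach spaces. Let $\Phi : X \to Y$ be a linear map with dense range, not assumed bounded. Let $T : X \to X$ be a linear map defined on all of $X$, not assumed bounded, and let $S : Y \to Y$ be a generalized scalar operator, that is, a bounded linear operator for which there is a continuous unital algebra homomorphism $f \mapsto f(S)$ from $C^\infty(\mathbb{R}^2)$ (complex-valued smooth functions, with the topology of uniform convergence of all derivatives on compact sets) to the Banach algebra $B(Y)$ of bounded linear operators on $Y$ such that $z(S) = S$, where $z(x,y) = x + iy$. If $\Phi T = S \Phi$, then $$\sigma(S) \subset \overline{\sigma(T)}.$$ Here $\sigma(S)$ is the spectrum of $S$ in $B(Y)$, and $\sigma(T)$ is the set of all $\lambda \in \mathbb{C}$ for which $T - \lambda 1 : X \to X$ is not bijective. -/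

import Mathlib

open scoped ContDiff

namespace GenScalar

/-- The complex algebra of functions `ℝ² → ℂ` that are `C^∞` in the real sense, with pointwise
operations. -/
def smoothSubalgebra : Subalgebra ℂ (ℝ × ℝ → ℂ) where
  carrier := {f | ContDiff ℝ ∞ f}
  mul_mem' {f g} (hf : ContDiff ℝ ∞ f) (hg : ContDiff ℝ ∞ g) := (hf.mul hg : ContDiff ℝ ∞ (f * g))
  add_mem' {f g} (hf : ContDiff ℝ ∞ f) (hg : ContDiff ℝ ∞ g) := (hf.add hg : ContDiff ℝ ∞ (f + g))
  algebraMap_mem' c := (contDiff_const : ContDiff ℝ ∞ fun _ : ℝ × ℝ => c)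

/-- The algebra `C^∞(ℝ²)`. It is a type of its own so that it does not inherit the topology of
pointwise convergence from `ℝ × ℝ → ℂ`; its topology is defined below. -/
def SmoothPlane : Type := smoothSubalgebra

namespace SmoothPlane

noncomputable instance : CommRing SmoothPlane := inferInstanceAs (CommRing smoothSubalgebra)

noncomputable instance : Algebra ℂ SmoothPlane := inferInstanceAs (Algebra ℂ smoothSubalgebra)

instance : CoeFun SmoothPlane (fun _ => ℝ × ℝ → ℂ) := ⟨fun f => f.1⟩

theorem contDiff (f : SmoothPlane) : ContDiff ℝ ∞ f := f.2

theorem bddAbove (K : TopologicalSpace.Compacts (ℝ × ℝ)) (n : ℕ) (f : SmoothPlane) :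
    BddAbove (Set.range fun x : K => ‖iteratedFDeriv ℝ n f x‖) := by
  have hc : Continuous fun x : ℝ × ℝ => ‖iteratedFDeriv ℝ n f x‖ :=
    (f.contDiff.continuous_iteratedFDeriv (by exact_mod_cast le_top)).norm
  obtain ⟨C, hC⟩ := K.isCompact.bddAbove_image hc.continuousOn
  refine ⟨C, ?_⟩
  rintro _ ⟨x, rfl⟩
  exact hC ⟨x, x.2, rfl⟩

/-- The seminorm `f ↦ sup_{x ∈ K} ‖Dⁿ f(x)‖` on `C^∞(ℝ²)`, for `K ⊆ ℝ²` compact and `n ∈ ℕ`. -/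
noncomputable def seminorm (K : TopologicalSpace.Compacts (ℝ × ℝ)) (n : ℕ) :
    Seminorm ℂ SmoothPlane :=
  Seminorm.ofSMulLE (fun f => ⨆ x : K, ‖iteratedFDeriv ℝ n f x‖)
    (by
      have h : ∀ x : ℝ × ℝ, ‖iteratedFDeriv ℝ n (0 : SmoothPlane) x‖ = 0 := by
        intro x
        have : ((0 : SmoothPlane) : ℝ × ℝ → ℂ) = 0 := rfl
        rw [this]
        simp
      simp [h])
    (by
      intro f g
      refine Real.iSup_le (fun x => ?_) (add_nonneg
        (Real.iSup_nonneg fun _ => norm_nonneg _) (Real.iSup_nonneg fun _ => norm_nonneg _))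
      have hfg : ((f + g : SmoothPlane) : ℝ × ℝ → ℂ) = f.1 + g.1 := rfl
      have hn : ((n : ℕ∞) : WithTop ℕ∞) ≤ ∞ := by exact_mod_cast le_top
      rw [hfg, iteratedFDeriv_add_apply (f.contDiff.of_le hn).contDiffAt
        (g.contDiff.of_le hn).contDiffAt]
      exact (norm_add_le _ _).trans
        (add_le_add (le_ciSup (bddAbove K n f) x) (le_ciSup (bddAbove K n g) x)))
    (by
      intro c f
      refine Real.iSup_le (fun x => ?_) (mul_nonneg (norm_nonneg _)
        (Real.iSup_nonneg fun _ => norm_nonneg _))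
      have hcf : ((c • f : SmoothPlane) : ℝ × ℝ → ℂ) = c • f.1 := rfl
      have hn : ((n : ℕ∞) : WithTop ℕ∞) ≤ ∞ := by exact_mod_cast le_top
      rw [hcf, iteratedFDeriv_const_smul_apply (f.contDiff.of_le hn).contDiffAt, norm_smul]
      exact mul_le_mul_of_nonneg_left (le_ciSup (bddAbove K n f) x) (norm_nonneg _))

/-- The defining family of seminorms, indexed by pairs `(K, n)`. -/
noncomputable def seminormFamily :
    SeminormFamily ℂ SmoothPlane (TopologicalSpace.Compacts (ℝ × ℝ) × ℕ) :=
  fun i => seminorm i.1 i.2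

/-- The usual Fréchet topology of `C^∞(ℝ²)`: the locally convex topology generated by the
seminorms `f ↦ sup_K ‖Dⁿ f‖`, i.e. uniform convergence on compact sets of all derivatives. -/
noncomputable instance : TopologicalSpace SmoothPlane :=
  seminormFamily.moduleFilterBasis.topology

/-- The function `z(x, y) = x + i y`. -/
noncomputable def z : SmoothPlane :=
  ⟨fun p => (p.1 : ℂ) + Complex.I * (p.2 : ℂ),
    show ContDiff ℝ ∞ fun p : ℝ × ℝ => (p.1 : ℂ) + Complex.I * (p.2 : ℂ) from
      (Complex.ofRealCLM.contDiff.comp contDiff_fst).add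
        (contDiff_const.mul (Complex.ofRealCLM.contDiff.comp contDiff_snd))⟩

end SmoothPlane

/-- A bounded operator `S` on `Y` is generalized scalar if there is a continuous unital algebra
homomorphism `C^∞(ℝ²) → B(Y)` (with the norm topology on `B(Y)`) mapping `z` to `S`. -/
def IsGeneralizedScalar {Y : Type*} [NormedAddCommGroup Y] [NormedSpace ℂ Y]
    (S : Y →L[ℂ] Y) : Prop :=
  ∃ φ : SmoothPlane →A[ℂ] (Y →L[ℂ] Y), φ SmoothPlane.z = S

end GenScalar

namespace GenScalar

open SmoothPlane

/-! For `x : X`, consider the vector-valued distribution `g ↦ φ g (Φ x)`. If `z a` lies off the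
closure of `σ(T)`, then `T - z a` is bijective, so the intertwining relation puts `Φ x` in the range
of every power of `S - z a`. The claim is that this divisibility on an open set `U` forces the
distribution to vanish there (`exists_vanishesNear`). Density of the range of `Φ` then gives `φ f =
0` for test functions `f` supported near a point `a` of `U`, and division by `z - z a` away from `a`
inverts `S - z a` (`isUnit_map_zSub`).

For the claim, let `m` be the order of `φ` and `y = (S - z a)^(m+3) w`. Then `φ g y = φ ((z - z
a)^(m+3) g) w`, so `‖φ g y‖ ≤ ‖w‖ ‖φ ((z - z a)^(m+3) g)‖`, with `w` depending on `a` in an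
uncontrolled way. Baire's theorem on the part of the support inside `U` makes the constant uniform
on a relatively open piece. There, cut a test function into `O(r⁻²)` cells of size `r`. A cell
missing the support contributes nothing; in any other, choose `a` in the support, and `(z - z
a)^(m+3)` makes the contribution `O(r³)`. The total is `O(r)`, hence zero, contradicting the choice
of a piece of the support. -/

theorem SmoothPlane.withSeminorms : WithSeminorms seminormFamily := ⟨rfl⟩

/-- A continuous linear map from `C^∞(ℝ²)` to a normed space has finite order. -/
theorem exists_order {E : Type*} [NormedAddCommGroup E] [NormedSpace ℂ E]
    (φ : SmoothPlane →ₗ[ℂ] E) (hφ : Continuous φ) :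
    ∃ (m : ℕ) (C : ℝ), 0 ≤ C ∧ ∀ (f : SmoothPlane) (M : ℝ), 0 ≤ M →
      (∀ k ≤ m, ∀ x, ‖iteratedFDeriv ℝ k f x‖ ≤ M) → ‖φ f‖ ≤ C * M := by
  obtain ⟨s, C, -, hC⟩ := Seminorm.bound_of_continuous SmoothPlane.withSeminorms
    ((normSeminorm ℂ E).comp φ) (by exact continuous_norm.comp hφ)
  -- The order is the largest derivative occurring in the finitely many dominating seminorms; their
  -- compact sets are irrelevant, since `M` bounds the derivatives on the whole plane.
  refine ⟨s.sup Prod.snd, C, C.2, fun f M hM h => (hC f).trans ?_⟩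
  refine mul_le_mul_of_nonneg_left (Seminorm.finset_sup_apply_le hM fun i hi => ?_) C.2
  exact Real.iSup_le (fun x => h _ (Finset.le_sup (f := Prod.snd) hi) _) hM

/-! ### Derivative estimates at scale `r` -/

/-- The derivatives of `h` at `x` of order at most `m` obey the bounds of a function of size
`C * r ^ a` at scale `r`. -/
def JetBound (m : ℕ) (r C : ℝ) (a : ℕ) (h : ℝ × ℝ → ℂ) (x : ℝ × ℝ) : Prop :=
  ∀ k ≤ m, ‖iteratedFDeriv ℝ k h x‖ ≤ C * r ^ a / r ^ k

/-- Every term of Leibniz's formula carries the same power of `r`; the binomial coefficients add up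
to `2 ^ k ≤ 2 ^ m`. -/
theorem JetBound.mul {m : ℕ} {r C D : ℝ} {a b : ℕ} {f g : ℝ × ℝ → ℂ} {x : ℝ × ℝ}
    (hr : 0 < r) (hC : 0 ≤ C) (hD : 0 ≤ D) (hf : ContDiff ℝ ∞ f) (hg : ContDiff ℝ ∞ g)
    (h : JetBound m r C a f x) (h' : JetBound m r D b g x) :
    JetBound m r (2 ^ m * (C * D)) (a + b) (fun y => f y * g y) x := by
  intro k hk
  calc ‖iteratedFDeriv ℝ k (fun y => f y * g y) x‖
      ≤ ∑ i ∈ Finset.range (k + 1), (k.choose i : ℝ) * ‖iteratedFDeriv ℝ i f x‖ *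
          ‖iteratedFDeriv ℝ (k - i) g x‖ :=
        norm_iteratedFDeriv_mul_le hf hg x (by exact_mod_cast le_top)
    _ ≤ ∑ i ∈ Finset.range (k + 1), (k.choose i : ℝ) * (C * D * r ^ (a + b) / r ^ k) := by
        refine Finset.sum_le_sum fun i hi => ?_
        have hik : i ≤ k := by simpa [Nat.lt_succ_iff] using hi
        have h1 := h i (hik.trans hk)
        have h2 := h' (k - i) ((Nat.sub_le _ _).trans hk)
        have h3 : C * r ^ a / r ^ i * (D * r ^ b / r ^ (k - i)) =
            C * D * r ^ (a + b) / r ^ k := by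
          rw [div_mul_div_comm, ← pow_add, Nat.add_sub_cancel' hik]
          ring
        rw [mul_assoc, ← h3]
        gcongr
    _ = 2 ^ k * (C * D * r ^ (a + b) / r ^ k) := by
        rw [← Finset.sum_mul]
        congr 1
        exact_mod_cast Nat.sum_range_choose k
    _ ≤ 2 ^ m * (C * D * r ^ (a + b) / r ^ k) := by
        gcongr
        norm_num
    _ = 2 ^ m * (C * D) * r ^ (a + b) / r ^ k := by ring

theorem exists_jetBound_pow (m p : ℕ) (C : ℝ) (hC : 0 ≤ C) : ∃ D : ℝ, 0 ≤ D ∧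
    ∀ (r : ℝ) (f : ℝ × ℝ → ℂ) (x : ℝ × ℝ), 0 < r → ContDiff ℝ ∞ f → JetBound m r C 1 f x →
      JetBound m r D p (fun y => f y ^ p) x := by
  induction p with
  | zero =>
    refine ⟨1, zero_le_one, fun r f x hr _ _ k _ => ?_⟩
    rcases k with _ | k
    · simp
    · simp only [pow_zero, iteratedFDeriv_succ_const]
      simp
      positivity
  | succ p ih =>
    obtain ⟨D, hD, h⟩ := ih
    refine ⟨2 ^ m * (D * C), by positivity, fun r f x hr hf hx => ?_⟩
    simp only [pow_succ]
    exact JetBound.mul hr hD hC (hf.pow p) hf (h r f x hr hf hx) hx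

theorem exists_jetBound_of_hasCompactSupport (m : ℕ) {f : ℝ × ℝ → ℂ} (hf : ContDiff ℝ ∞ f)
    (hs : HasCompactSupport f) :
    ∃ C : ℝ, 0 ≤ C ∧ ∀ k ≤ m, ∀ x, ‖iteratedFDeriv ℝ k f x‖ ≤ C := by
  have h : ∀ k : ℕ, ∃ C, ∀ x, ‖iteratedFDeriv ℝ k f x‖ ≤ C := fun k =>
    (hf.continuous_iteratedFDeriv (by exact_mod_cast le_top)).bounded_above_of_compact_support
      (hs.iteratedFDeriv k)
  choose C hC using h
  refine ⟨∑ k ∈ Finset.range (m + 1), |C k|, Finset.sum_nonneg fun _ _ => abs_nonneg _,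
    fun k hk x => (hC k x).trans ((le_abs_self _).trans ?_)⟩
  exact Finset.single_le_sum (f := fun k => |C k|) (fun _ _ => abs_nonneg _)
    (Finset.mem_range.2 (Nat.lt_succ_of_le hk))

theorem norm_z_sub_z_le (x y : ℝ × ℝ) : ‖z x - z y‖ ≤ 2 * ‖x - y‖ := by
  have h : z x - z y = ((x.1 - y.1 : ℝ) : ℂ) + Complex.I * ((x.2 - y.2 : ℝ) : ℂ) := by
    simp only [z]; push_cast; ring
  rw [h]
  refine (norm_add_le _ _).trans ?_
  rw [norm_mul, Complex.norm_I, one_mul, Complex.norm_real, Complex.norm_real, two_mul]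
  exact add_le_add (norm_fst_le (x - y)) (norm_snd_le (x - y))

theorem jetBound_z_sub (m : ℕ) {r : ℝ} (hr : 0 < r) {x y : ℝ × ℝ} (h : ‖x - y‖ ≤ 2 * r) :
    JetBound m r 4 1 (fun u => z u - z y) x := by
  let L : ℝ × ℝ →L[ℝ] ℂ := Complex.ofRealCLM.comp (ContinuousLinearMap.fst ℝ ℝ ℝ) +
    Complex.I • Complex.ofRealCLM.comp (ContinuousLinearMap.snd ℝ ℝ ℝ)
  have hL : ∀ u, z u = L u := fun u => by simp [L, z]
  have hfd : fderiv ℝ (fun u => z u - z y) = fun _ => L := by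
    funext u
    rw [fderiv_sub_const]
    have : (z : ℝ × ℝ → ℂ) = L := funext hL
    rw [this, L.fderiv]
  have hnL : ‖L‖ ≤ 2 := L.opNorm_le_bound (by norm_num) fun u => by
    have := norm_z_sub_z_le u 0
    simpa [hL] using this
  rintro (_ | _ | k) hk
  · rw [norm_iteratedFDeriv_zero]
    have := norm_z_sub_z_le x y
    simp only [pow_one, pow_zero, div_one]
    linarith
  · rw [← norm_iteratedFDeriv_fderiv, hfd, norm_iteratedFDeriv_zero]
    simp only [zero_add, pow_one]
    rw [mul_div_cancel_right₀ _ hr.ne']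
    linarith
  · rw [← norm_iteratedFDeriv_fderiv, hfd, iteratedFDeriv_succ_const]
    simp
    positivity

/-! ### Partition of unity into cells of size `r` -/

/-- The function on `ℝ` supported in `[-1, 1]` whose integer translates sum to `1`. -/
noncomputable def hat (t : ℝ) : ℝ := Real.smoothTransition (t + 1) - Real.smoothTransition t

theorem contDiff_hat : ContDiff ℝ ∞ hat :=
  (Real.smoothTransition.contDiff.comp (contDiff_id.add contDiff_const)).sub
    Real.smoothTransition.contDiff

theorem hat_eq_zero {t : ℝ} (h : 1 < |t|) : hat t = 0 := by
  rcases lt_abs.1 h with h | h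
  · rw [hat, Real.smoothTransition.one_of_one_le (by linarith),
      Real.smoothTransition.one_of_one_le (by linarith), sub_self]
  · rw [hat, Real.smoothTransition.zero_of_nonpos (by linarith),
      Real.smoothTransition.zero_of_nonpos (by linarith), sub_self]

/-- The sum telescopes to `Real.smoothTransition` at `t + N + 1` minus its value at `t - N`, that is
`1 - 0`. -/
theorem sum_hat (N : ℕ) {t : ℝ} (h : |t| ≤ N) :
    ∑ i ∈ Finset.range (2 * N + 1), hat (t - ((i : ℝ) - N)) = 1 := by
  obtain ⟨h1, h2⟩ := abs_le.1 h
  have := Finset.sum_range_sub' (fun i : ℕ => Real.smoothTransition (t + N + 1 - i)) (2 * N + 1)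
  rw [Real.smoothTransition.zero_of_nonpos (x := t + N + 1 - ((2 * N + 1 : ℕ) : ℝ))
      (by push_cast; linarith),
    Real.smoothTransition.one_of_one_le (by push_cast; linarith), sub_zero] at this
  rw [← this]
  refine Finset.sum_congr rfl fun i _ => ?_
  rw [hat]
  congr 2
  · ring
  · push_cast; ring

/-- The product of two copies of `hat`. -/
noncomputable def hat₂ (u : ℝ × ℝ) : ℂ := (hat u.1 : ℂ) * (hat u.2 : ℂ)

theorem contDiff_hat₂ : ContDiff ℝ ∞ hat₂ :=
  (Complex.ofRealCLM.contDiff.comp (contDiff_hat.comp contDiff_fst)).mul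
    (Complex.ofRealCLM.contDiff.comp (contDiff_hat.comp contDiff_snd))

theorem hat₂_eq_zero {u : ℝ × ℝ} (h : 1 < ‖u‖) : hat₂ u = 0 := by
  rw [Prod.norm_def, lt_max_iff] at h
  rcases h with h | h
  · simp [hat₂, hat_eq_zero h]
  · simp [hat₂, hat_eq_zero h]

theorem hasCompactSupport_hat₂ : HasCompactSupport hat₂ :=
  HasCompactSupport.intro (isCompact_closedBall (0 : ℝ × ℝ) 1) fun x hx =>
    hat₂_eq_zero (by simpa using hx)

/-- The translate of `hat₂` by `c`, rescaled to scale `r`. -/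
noncomputable def cell (r : ℝ) (c : ℝ × ℝ) : SmoothPlane :=
  ⟨fun x => hat₂ (r⁻¹ • x - c), show ContDiff ℝ ∞ fun x : ℝ × ℝ => hat₂ (r⁻¹ • x - c) from
    contDiff_hat₂.comp ((contDiff_id.const_smul r⁻¹).sub contDiff_const)⟩

theorem cell_eq_zero {r : ℝ} (hr : 0 < r) {c x : ℝ × ℝ} (h : r < ‖x - r • c‖) :
    cell r c x = 0 := by
  refine hat₂_eq_zero ?_
  have : r⁻¹ • x - c = r⁻¹ • (x - r • c) := by
    rw [smul_sub, smul_smul, inv_mul_cancel₀ hr.ne', one_smul]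
  rw [this, norm_smul, Real.norm_of_nonneg (inv_nonneg.2 hr.le), ← div_eq_inv_mul]
  exact (one_lt_div hr).2 h

/-- By the chain rule each derivative costs a factor `r⁻¹`; translation costs nothing, so one
constant serves all cells. -/
theorem exists_jetBound_cell (m : ℕ) : ∃ C : ℝ, 0 ≤ C ∧ ∀ (r : ℝ) (c x : ℝ × ℝ), 0 < r →
    JetBound m r C 0 (cell r c) x := by
  obtain ⟨C, hC, h⟩ := exists_jetBound_of_hasCompactSupport m contDiff_hat₂ hasCompactSupport_hat₂
  refine ⟨C, hC, fun r c x hr k hk => ?_⟩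
  let L : ℝ × ℝ →L[ℝ] ℝ × ℝ := r⁻¹ • ContinuousLinearMap.id ℝ (ℝ × ℝ)
  have hL : ‖L‖ ≤ r⁻¹ := L.opNorm_le_bound (by positivity) fun u => by
    simp [L, norm_smul, abs_of_pos hr]
  have hc : ((cell r c : SmoothPlane) : ℝ × ℝ → ℂ) = (fun u => hat₂ (u - c)) ∘ L := rfl
  have hs : ContDiff ℝ ∞ fun u => hat₂ (u - c) :=
    contDiff_hat₂.comp (contDiff_id.sub contDiff_const)
  rw [hc, L.iteratedFDeriv_comp_right hs x (by exact_mod_cast le_top)]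
  refine (ContinuousMultilinearMap.norm_compContinuousLinearMap_le _ _).trans ?_
  rw [iteratedFDeriv_comp_sub, Finset.prod_const, Finset.card_univ, Fintype.card_fin, pow_zero,
    mul_one, div_eq_mul_inv, ← inv_pow]
  exact mul_le_mul (h k hk _) (pow_le_pow_left₀ (norm_nonneg _) hL k) (by positivity) hC

/-- The integer points of the square `[-N, N]²`, at which the cells are placed. -/
noncomputable def grid (N : ℕ) (i : ℕ × ℕ) : ℝ × ℝ := ((i.1 : ℝ) - N, (i.2 : ℝ) - N)

theorem sum_cell (N : ℕ) {r : ℝ} (hr : 0 < r) {x : ℝ × ℝ} (hx : ‖x‖ ≤ N * r) :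
    ∑ i ∈ Finset.range (2 * N + 1) ×ˢ Finset.range (2 * N + 1), cell r (grid N i) x = 1 := by
  have h1 : |r⁻¹ * x.1| ≤ N := by
    rw [abs_mul, abs_of_pos (inv_pos.2 hr), ← div_eq_inv_mul, div_le_iff₀ hr]
    exact (norm_fst_le x).trans hx
  have h2 : |r⁻¹ * x.2| ≤ N := by
    rw [abs_mul, abs_of_pos (inv_pos.2 hr), ← div_eq_inv_mul, div_le_iff₀ hr]
    exact (norm_snd_le x).trans hx
  have h1' : ∑ i ∈ Finset.range (2 * N + 1), ((hat (r⁻¹ * x.1 - ((i : ℝ) - N)) : ℝ) : ℂ) = 1 := by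
    exact_mod_cast sum_hat N h1
  have h2' : ∑ i ∈ Finset.range (2 * N + 1), ((hat (r⁻¹ * x.2 - ((i : ℝ) - N)) : ℝ) : ℂ) = 1 := by
    exact_mod_cast sum_hat N h2
  calc _ = ∑ i ∈ Finset.range (2 * N + 1) ×ˢ Finset.range (2 * N + 1),
        ((hat (r⁻¹ * x.1 - ((i.1 : ℝ) - N)) : ℝ) : ℂ) *
          ((hat (r⁻¹ * x.2 - ((i.2 : ℝ) - N)) : ℝ) : ℂ) := rfl
    _ = 1 := by
        rw [Finset.sum_product]
        dsimp only
        rw [← Finset.sum_mul_sum, h1', h2', one_mul]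

theorem sum_mul_cell (N : ℕ) {r : ℝ} (hr : 0 < r) (f : SmoothPlane)
    (hf : ∀ x, f x ≠ 0 → ‖x‖ ≤ N * r) :
    ∑ i ∈ Finset.range (2 * N + 1) ×ˢ Finset.range (2 * N + 1), f * cell r (grid N i) = f := by
  rw [← Finset.mul_sum]
  have hev : ∀ x, (∑ i ∈ Finset.range (2 * N + 1) ×ˢ Finset.range (2 * N + 1),
      cell r (grid N i)) x = ∑ i ∈ Finset.range (2 * N + 1) ×ˢ Finset.range (2 * N + 1),
      cell r (grid N i) x := fun x =>
    map_sum ((Pi.evalRingHom (fun _ : ℝ × ℝ => ℂ) x).comp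
      (smoothSubalgebra.val : smoothSubalgebra →+* (ℝ × ℝ → ℂ))) _ _
  apply Subtype.ext
  funext x
  change f x * _ = f x
  by_cases h : f x = 0
  · rw [h, zero_mul]
  · rw [hev, sum_cell N hr (hf x h), mul_one]

/-- The function `z - z(a)` for a point `a` of the plane. -/
noncomputable def zSub (a : ℝ × ℝ) : SmoothPlane := z - algebraMap ℂ SmoothPlane (z a)

/-- On the cell `z - z a` is `O(r)`, so its power gives `r ^ (m + 3)`, of which at most `m`
derivatives consume `r ^ m`. The surviving `r ^ 3` beats the `O(r⁻²)` number of cells in the plane.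
-/
theorem exists_bound_zSub_pow_mul_cell (m : ℕ) (f : SmoothPlane) (hf : HasCompactSupport f) :
    ∃ C : ℝ, 0 ≤ C ∧ ∀ (r : ℝ) (c a : ℝ × ℝ), 0 < r → r ≤ 1 → ‖a - r • c‖ ≤ r →
      ∀ k ≤ m, ∀ x, ‖iteratedFDeriv ℝ k (zSub a ^ (m + 3) * (f * cell r c) : SmoothPlane) x‖ ≤
        C * r ^ 3 := by
  obtain ⟨C₁, hC₁, h₁⟩ := exists_jetBound_of_hasCompactSupport m f.contDiff hf
  obtain ⟨C₂, hC₂, h₂⟩ := exists_jetBound_cell m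
  obtain ⟨C₃, hC₃, h₃⟩ := exists_jetBound_pow m (m + 3) 4 (by norm_num)
  refine ⟨2 ^ m * (C₃ * (2 ^ m * (C₁ * C₂))), by positivity, fun r c a hr hr1 ha k hk x => ?_⟩
  by_cases hx : ‖x - r • c‖ ≤ r
  · have hxa : ‖x - a‖ ≤ 2 * r := by
      have := norm_sub_le (x - r • c) (a - r • c)
      rw [sub_sub_sub_cancel_right] at this
      linarith
    -- The bounds on `f` do not depend on the scale; they fit scale `r` because `r ≤ 1`.
    have j₁ : JetBound m r C₁ 0 f x := fun i hi => by
      refine (h₁ i hi x).trans ?_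
      rw [pow_zero, mul_one, le_div_iff₀ (by positivity)]
      exact mul_le_of_le_one_right hC₁ (pow_le_one₀ hr.le hr1)
    have j₃ := h₃ r (zSub a) x hr (zSub a).contDiff (jetBound_z_sub m hr hxa)
    have j := JetBound.mul hr hC₃ (by positivity) ((zSub a).contDiff.pow (m + 3))
      (f.contDiff.mul (cell r c).contDiff) j₃
      (JetBound.mul hr hC₁ hC₂ f.contDiff (cell r c).contDiff j₁ (h₂ r c x hr)) k hk
    refine (show _ ≤ _ from j).trans ?_
    rw [mul_div_assoc]
    refine mul_le_mul_of_nonneg_left ?_ (by positivity)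
    rw [div_le_iff₀ (by positivity), ← pow_add]
    exact pow_le_pow_of_le_one hr.le hr1 (by omega)
  · have h0 : ((zSub a ^ (m + 3) * (f * cell r c) : SmoothPlane) : ℝ × ℝ → ℂ) =ᶠ[nhds x]
        fun _ => 0 := by
      have ho : IsOpen {u : ℝ × ℝ | r < ‖u - r • c‖} :=
        isOpen_lt continuous_const (by fun_prop)
      filter_upwards [ho.mem_nhds (not_le.1 hx)] with u hu
      change (zSub a ^ (m + 3) : SmoothPlane) u * (f u * cell r c u) = 0
      rw [cell_eq_zero hr hu, mul_zero, mul_zero]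
    rw [(h0.iteratedFDeriv ℝ k).eq_of_nhds]
    simp only [iteratedFDeriv_fun_zero, Pi.zero_apply, norm_zero]
    positivity

theorem exists_pos_norm_le_of_hasCompactSupport {f : ℝ × ℝ → ℂ} (hf : HasCompactSupport f) :
    ∃ R > 0, ∀ x, f x ≠ 0 → ‖x‖ ≤ R := by
  obtain ⟨R, hR⟩ := IsCompact.isBounded hf |>.exists_norm_le
  exact ⟨max R 1, lt_max_of_lt_right one_pos, fun x hx =>
    (hR x (subset_tsupport f hx)).trans (le_max_left _ _)⟩

/-! ### Local vanishing and supports of the distributions `g ↦ φ g y` -/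

section

variable {Y : Type*} [NormedAddCommGroup Y] [NormedSpace ℂ Y]

/-- The vector-valued distribution `g ↦ φ g y` vanishes near the point `a`. -/
def VanishesNear (φ : SmoothPlane →A[ℂ] (Y →L[ℂ] Y)) (y : Y) (a : ℝ × ℝ) : Prop :=
  ∃ ε > 0, ∀ g : SmoothPlane, (∀ x, g x ≠ 0 → dist x a < ε) → φ g y = 0

theorem isOpen_vanishesNear (φ : SmoothPlane →A[ℂ] (Y →L[ℂ] Y)) (y : Y) :
    IsOpen {a | VanishesNear φ y a} := by
  rw [Metric.isOpen_iff]
  rintro a ⟨ε, hε, h⟩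
  refine ⟨ε / 2, by positivity, fun b hb => ⟨ε / 2, by positivity, fun g hg => h g fun x hx => ?_⟩⟩
  have := dist_triangle x b a
  have := hg x hx
  have := Metric.mem_ball.1 hb
  linarith

theorem apply_eq_sum_cell (φ : SmoothPlane →A[ℂ] (Y →L[ℂ] Y)) (y : Y) (N : ℕ) {r : ℝ}
    (hr : 0 < r) (f : SmoothPlane) (hf : ∀ x, f x ≠ 0 → ‖x‖ ≤ N * r) :
    φ f y = ∑ i ∈ Finset.range (2 * N + 1) ×ˢ Finset.range (2 * N + 1),
      φ (f * cell r (grid N i)) y := by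
  conv_lhs => rw [← sum_mul_cell N hr f hf]
  rw [map_sum, _root_.sum_apply]

/-- Local vanishing becomes global by a partition of unity finer than a Lebesgue number of the cover
of the support by balls of vanishing. -/
theorem apply_eq_zero_of_vanishesNear (φ : SmoothPlane →A[ℂ] (Y →L[ℂ] Y)) (y : Y)
    (f : SmoothPlane) (hf : HasCompactSupport f) (h : ∀ a ∈ tsupport f, VanishesNear φ y a) :
    φ f y = 0 := by
  choose ε hε hv using h
  obtain ⟨δ, hδ, hleb⟩ := lebesgue_number_lemma_of_metric (ι := tsupport f) hf
    (c := fun a => Metric.ball a.1 (ε a.1 a.2)) (fun _ => Metric.isOpen_ball)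
    fun a ha => Set.mem_iUnion.2 ⟨⟨a, ha⟩, Metric.mem_ball_self (hε a ha)⟩
  obtain ⟨R, hR, hfR⟩ := exists_pos_norm_le_of_hasCompactSupport hf
  obtain ⟨N, hN⟩ := exists_nat_gt (2 * R / δ)
  have hN0 : (0 : ℝ) < N := lt_of_le_of_lt (by positivity) hN
  have hr : 0 < R / N := by positivity
  -- Two points of one cell are at most twice its radius apart.
  have hrδ : 2 * (R / N) < δ := by
    rw [div_lt_iff₀ hδ] at hN
    rw [← mul_div_assoc, div_lt_iff₀ hN0]
    linarith
  rw [apply_eq_sum_cell φ y N hr f fun x hx => by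
    rw [mul_div_cancel₀ _ hN0.ne']; exact hfR x hx]
  refine Finset.sum_eq_zero fun i _ => ?_
  set c := grid N i
  have hc : ∀ x, (f * cell (R / N) c) x ≠ 0 → f x ≠ 0 ∧ ‖x - (R / N) • c‖ ≤ R / N := by
    intro x hx
    change f x * cell (R / N) c x ≠ 0 at hx
    exact ⟨left_ne_zero_of_mul hx, not_lt.1 fun h => right_ne_zero_of_mul hx (cell_eq_zero hr h)⟩
  by_cases h0 : ∃ x₀, (f * cell (R / N) c) x₀ ≠ 0
  · obtain ⟨x₀, hx₀⟩ := h0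
    obtain ⟨⟨a, ha⟩, hball⟩ := hleb x₀ (subset_tsupport f (hc x₀ hx₀).1)
    refine hv a ha _ fun x hx => hball ?_
    rw [Metric.mem_ball, dist_eq_norm]
    have := norm_sub_le (x - (R / N) • c) (x₀ - (R / N) • c)
    rw [sub_sub_sub_cancel_right] at this
    linarith [(hc x hx).2, (hc x₀ hx₀).2]
  · push Not at h0
    have : f * cell (R / N) c = 0 := Subtype.ext (funext h0)
    rw [this, map_zero, _root_.zero_apply]

/-- If the multiplication by `(z - z(a)) ^ (m + 3)`, with `m` the order of `φ`, is uniformly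
injective on the distribution `g ↦ φ g y` for `a` in the support of that distribution within a
neighbourhood of the support of `f`, then `φ f y = 0`. -/
theorem apply_eq_zero_of_uniform_bound (φ : SmoothPlane →A[ℂ] (Y →L[ℂ] Y)) (y : Y) {m : ℕ}
    {C n : ℝ} (hC : 0 ≤ C) (hn : 0 ≤ n)
    (hord : ∀ (f : SmoothPlane) (M : ℝ), 0 ≤ M →
      (∀ k ≤ m, ∀ x, ‖iteratedFDeriv ℝ k f x‖ ≤ M) → ‖φ f‖ ≤ C * M)
    (f : SmoothPlane) (hf : HasCompactSupport f)
    (h : ∀ a ∈ tsupport f, ¬ VanishesNear φ y a →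
      ∀ g : SmoothPlane, ‖φ g y‖ ≤ n * ‖φ (zSub a ^ (m + 3) * g)‖) :
    φ f y = 0 := by
  obtain ⟨D, hD, hb⟩ := exists_bound_zSub_pow_mul_cell m f hf
  obtain ⟨R, hR, hfR⟩ := exists_pos_norm_le_of_hasCompactSupport hf
  have hcell : ∀ (r : ℝ) (c : ℝ × ℝ), 0 < r → r ≤ 1 →
      ‖φ (f * cell r c) y‖ ≤ n * (C * (D * r ^ 3)) := by
    intro r c hr hr1
    have hle : tsupport (f * cell r c : SmoothPlane) ⊆ tsupport f :=
      closure_mono fun x hx => left_ne_zero_of_mul (show f x * cell r c x ≠ 0 from hx)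
    -- Either the localized function avoids the support of the distribution, or its closed support
    -- contains a point `a` to which the uniform bound applies.
    by_cases hv : ∀ a ∈ tsupport (f * cell r c : SmoothPlane), VanishesNear φ y a
    · rw [apply_eq_zero_of_vanishesNear φ y _
        (hf.of_isClosed_subset (isClosed_tsupport _) hle) hv, norm_zero]
      positivity
    · push Not at hv
      obtain ⟨a, ha, hav⟩ := hv
      have hac : ‖a - r • c‖ ≤ r := by
        have hcl : IsClosed {u : ℝ × ℝ | ‖u - r • c‖ ≤ r} :=
          isClosed_le (by fun_prop) continuous_const
        refine closure_minimal (fun x hx => ?_) hcl ha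
        exact not_lt.1 fun h => right_ne_zero_of_mul (show f x * cell r c x ≠ 0 from hx)
          (cell_eq_zero hr h)
      refine (h a (hle ha) hav _).trans (mul_le_mul_of_nonneg_left ?_ hn)
      exact hord _ _ (by positivity) (hb r c a hr hr1 hac)
  have hlim : ∀ N : ℕ, 1 ≤ N → R ≤ N → ‖φ f y‖ ≤ 9 * (n * (C * (D * R ^ 3))) / N := by
    intro N hN hRN
    have hN1 : (1 : ℝ) ≤ N := by exact_mod_cast hN
    have hN0 : (0 : ℝ) < N := by linarith
    have hr : 0 < R / N := by positivity
    have hr1 : R / N ≤ 1 := (div_le_one hN0).2 hRN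
    rw [apply_eq_sum_cell φ y N hr f fun x hx => by
      rw [mul_div_cancel₀ _ hN0.ne']; exact hfR x hx]
    refine (norm_sum_le _ _).trans ((Finset.sum_le_card_nsmul _ _ _ fun i _ =>
      hcell (R / N) (grid N i) hr hr1).trans ?_)
    rw [Finset.card_product, Finset.card_range, nsmul_eq_mul]
    push_cast
    -- There are `(2N + 1)² ≤ 9N²` cells, each contributing `O(N⁻³)`.
    have h9 : (2 * (N : ℝ) + 1) * (2 * N + 1) ≤ 9 * (N : ℝ) ^ 2 := by nlinarith
    calc (2 * (N : ℝ) + 1) * (2 * N + 1) * (n * (C * (D * (R / N) ^ 3)))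
        ≤ 9 * (N : ℝ) ^ 2 * (n * (C * (D * (R / N) ^ 3))) := by gcongr
      _ = 9 * (n * (C * (D * R ^ 3))) / N := by field_simp
  have h0 : ‖φ f y‖ ≤ 0 := by
    refine ge_of_tendsto (tendsto_const_div_atTop_nhds_zero_nat (9 * (n * (C * (D * R ^ 3))))) ?_
    filter_upwards [Filter.eventually_ge_atTop 1, Filter.eventually_ge_atTop ⌈R⌉₊] with N h1 h2
    exact hlim N h1 (Nat.ceil_le.1 h2)
  exact norm_le_zero_iff.1 h0

theorem map_zSub (φ : SmoothPlane →A[ℂ] (Y →L[ℂ] Y)) (a : ℝ × ℝ) :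
    φ (zSub a) = φ z - algebraMap ℂ (Y →L[ℂ] Y) (z a) := by
  rw [zSub, map_sub]
  congr 1
  exact AlgHomClass.commutes φ (z a)

/-- If `y` lies in the range of a high power of `φ (z - z(a))` for every `a` in an open set, then
the distribution `g ↦ φ g y` vanishes there. -/
theorem exists_vanishesNear (φ : SmoothPlane →A[ℂ] (Y →L[ℂ] Y)) (y : Y) {U : Set (ℝ × ℝ)}
    (hU : IsOpen U) (h : ∀ a ∈ U, ∀ p : ℕ, ∃ w, (φ (zSub a) ^ p) w = y) :
    ∀ a ∈ U, VanishesNear φ y a := by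
  obtain ⟨m, C, hC, hord⟩ := exists_order (φ : SmoothPlane →ₗ[ℂ] (Y →L[ℂ] Y)) φ.cont
  by_contra! hcon
  obtain ⟨a₀, ha₀, hv₀⟩ := hcon
  -- Baire is applied to the support within `U`, not to `U` itself, so that the open piece obtained
  -- meets the support. Being locally closed in the plane, `F` is a Baire space.
  set F : Set (ℝ × ℝ) := U ∩ {a | VanishesNear φ y a}ᶜ
  have hF : IsLocallyClosed F :=
    hU.isLocallyClosed.inter (isOpen_vanishesNear φ y).isClosed_compl.isLocallyClosed
  have : LocallyCompactSpace F := hF.locallyCompactSpace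
  have : Nonempty F := ⟨⟨a₀, ha₀, hv₀⟩⟩
  let A : ℕ → Set F := fun n =>
    {a | ∀ g : SmoothPlane, ‖φ g y‖ ≤ n * ‖φ (zSub a.1 ^ (m + 3) * g)‖}
  have hA : ∀ n, IsClosed (A n) := by
    -- Closedness holds because `φ (zSub a) = φ z - z a` depends norm-continuously on `a`.
    intro n
    simp only [A, Set.ofPred_forall]
    refine isClosed_iInter fun g => isClosed_le continuous_const ?_
    have hz : Continuous (z : ℝ × ℝ → ℂ) := z.contDiff.continuous
    simp only [map_mul, map_pow, map_zSub]
    have : Continuous (algebraMap ℂ (Y →L[ℂ] Y)) := continuous_algebraMap ℂ _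
    fun_prop
  have hcov : ⋃ n, A n = Set.univ := by
    refine Set.eq_univ_of_forall fun a => ?_
    -- The norm of any preimage `w` of `y` under the power serves as the constant at `a`.
    obtain ⟨w, hw⟩ := h a.1 a.2.1 (m + 3)
    obtain ⟨n, hn⟩ := exists_nat_ge ‖w‖
    refine Set.mem_iUnion.2 ⟨n, fun g => ?_⟩
    have : φ g y = φ (zSub a.1 ^ (m + 3) * g) w := by
      rw [mul_comm, map_mul, map_pow, mul_apply_eq_comp, hw]
    rw [this, mul_comm (n : ℝ)]
    exact ContinuousLinearMap.le_opNorm_of_le _ hn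
  obtain ⟨n, ⟨a, haU, hav⟩, hint⟩ := nonempty_interior_of_iUnion_of_closed hA hcov
  obtain ⟨V, hV, hVA⟩ := isOpen_induced_iff.1 (isOpen_interior (s := A n))
  have haV : a ∈ V := by
    rw [← hVA] at hint
    exact hint
  obtain ⟨ε, hε, hball⟩ := Metric.isOpen_iff.1 (hV.inter hU) a ⟨haV, haU⟩
  refine hav ⟨ε / 2, by positivity, fun f hf => ?_⟩
  have hts : tsupport f ⊆ Metric.closedBall a (ε / 2) :=
    closure_minimal (fun x hx => (hf x hx).le) Metric.isClosed_closedBall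
  refine apply_eq_zero_of_uniform_bound φ y hC (Nat.cast_nonneg n) hord f
    ((isCompact_closedBall a (ε / 2)).of_isClosed_subset (isClosed_tsupport _) hts)
    fun b hb hbv => ?_
  have hbVU := hball (Metric.closedBall_subset_ball (by linarith) (hts hb))
  have hbA : (⟨b, hbVU.2, hbv⟩ : F) ∈ interior (A n) := by
    rw [← hVA]
    exact hbVU.1
  exact interior_subset hbA

/-- If `φ` kills the functions supported in a ball around `a`, then `φ (z - z(a))` is
invertible. -/
theorem isUnit_map_zSub (φ : SmoothPlane →A[ℂ] (Y →L[ℂ] Y)) {a : ℝ × ℝ} {ε : ℝ} (hε : 0 < ε)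
    (h : ∀ f : SmoothPlane, HasCompactSupport f → tsupport f ⊆ Metric.ball a ε → φ f = 0) :
    IsUnit (φ (zSub a)) := by
  let b : ContDiffBump a := ⟨ε / 4, ε / 2, by positivity, by linarith⟩
  let χ : SmoothPlane := ⟨fun x => (b x : ℂ), show ContDiff ℝ ∞ fun x => (b x : ℂ) from
    Complex.ofRealCLM.contDiff.comp b.contDiff⟩
  have hχs : Function.support χ ⊆ Function.support b := fun x hx hb =>
    hx (show ((b x : ℝ) : ℂ) = 0 by rw [hb, Complex.ofReal_zero])
  have hχt : tsupport χ ⊆ Metric.closedBall a (ε / 2) := by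
    have := closure_mono hχs
    exact this.trans b.tsupport_eq.subset
  have hχ : φ χ = 0 := h χ
    ((isCompact_closedBall a (ε / 2)).of_isClosed_subset (isClosed_tsupport _) hχt)
    (hχt.trans (Metric.closedBall_subset_ball (by linarith)))
  have hz : ∀ x, zSub a x = 0 → x = a := by
    intro x hx
    have hx' : ((x.1 : ℂ) + Complex.I * x.2) - (a.1 + Complex.I * a.2) = 0 := hx
    have hre := congrArg Complex.re hx'
    have him := congrArg Complex.im hx'
    simp at hre him
    exact Prod.ext (by linarith) (by linarith)
  have hone : ∀ x ∈ Metric.closedBall a (ε / 4), χ x = 1 := fun x hx =>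
    show ((b x : ℝ) : ℂ) = 1 by rw [b.one_of_mem_closedBall hx, Complex.ofReal_one]
  -- The quotient is smooth across `a` because `1 - χ` vanishes on a neighbourhood of `a`.
  have hψ : ContDiff ℝ ∞ fun x => (1 - χ x) * (zSub a x)⁻¹ := by
    rw [contDiff_iff_contDiffAt]
    intro x
    by_cases hx : x = a
    · have : (fun x => (1 - χ x) * (zSub a x)⁻¹) =ᶠ[nhds x] fun _ => 0 := by
        rw [hx]
        filter_upwards [Metric.closedBall_mem_nhds a (show 0 < ε / 4 by positivity)] with u hu
        rw [hone u hu, sub_self, zero_mul]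
      exact contDiffAt_const.congr_of_eventuallyEq this
    · exact (contDiffAt_const.sub χ.contDiff.contDiffAt).mul
        ((zSub a).contDiff.contDiffAt.inv fun h0 => hx (hz x h0))
  let ψ : SmoothPlane := ⟨_, hψ⟩
  have hmul : zSub a * ψ = 1 - χ := by
    apply Subtype.ext
    funext x
    change zSub a x * ((1 - χ x) * (zSub a x)⁻¹) = 1 - χ x
    by_cases h0 : zSub a x = 0
    · rw [h0, zero_mul, hone x, sub_self]
      rw [hz x h0]
      exact Metric.mem_closedBall_self (by positivity)
    · field_simp
  have h1 : φ (zSub a) * φ ψ = 1 := by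
    rw [← map_mul, hmul, map_sub, hχ, map_one, sub_zero]
  have h2 : φ ψ * φ (zSub a) = 1 := by
    rw [← map_mul, mul_comm, map_mul, h1]
  exact ⟨⟨_, _, h1, h2⟩, rfl⟩

end

end GenScalar

/-! ### Transfer from `T` to `S` through `Φ` -/

theorem mainTheorem5 {X Y : Type*}
    [NormedAddCommGroup X] [NormedSpace ℂ X] [CompleteSpace X]
    [NormedAddCommGroup Y] [NormedSpace ℂ Y] [CompleteSpace Y]
    (Φ : X →ₗ[ℂ] Y) (hΦ : DenseRange Φ)
    (T : X →ₗ[ℂ] X) (S : Y →L[ℂ] Y) (hS : GenScalar.IsGeneralizedScalar S)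
    (hint : Φ ∘ₗ T = (S : Y →ₗ[ℂ] Y) ∘ₗ Φ) :
    spectrum ℂ S ⊆ closure (spectrum ℂ (T : Module.End ℂ X)) := by
  open GenScalar SmoothPlane in
  obtain ⟨φ, rfl⟩ := hS
  intro μ hμ
  by_contra hcl
  let U : Set (ℝ × ℝ) := z ⁻¹' (closure (spectrum ℂ (T : Module.End ℂ X)))ᶜ
  have hU : IsOpen U := isClosed_closure.isOpen_compl.preimage z.contDiff.continuous
  have hza : z (μ.re, μ.im) = μ := by
    change (μ.re : ℂ) + Complex.I * μ.im = μ
    rw [mul_comm, Complex.re_add_im]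
  have haU : (μ.re, μ.im) ∈ U := by
    change z (μ.re, μ.im) ∈ (closure (spectrum ℂ (T : Module.End ℂ X)))ᶜ
    rw [hza]
    exact hcl
  have hint' : ∀ x, Φ (T x) = φ z (Φ x) := fun x => LinearMap.congr_fun hint x
  have hpow : ∀ a ∈ U, ∀ (p : ℕ) (x : X), ∃ x', (φ (zSub a) ^ p) (Φ x') = Φ x := by
    intro a ha p
    have hunit : IsUnit (algebraMap ℂ (Module.End ℂ X) (z a) - T) :=
      spectrum.notMem_iff.1 fun hmem => ha (subset_closure hmem)
    have hsurj := ((Module.End.isUnit_iff _).1 hunit).2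
    induction p with
    | zero => exact fun x => ⟨x, rfl⟩
    | succ p ih =>
      intro x
      obtain ⟨x₁, hx₁⟩ := hsurj x
      -- The sign accounts for `spectrum` using `z a - T`, while `zSub a` maps to `S - z a`.
      obtain ⟨x₂, hx₂⟩ := ih (-x₁)
      refine ⟨x₂, ?_⟩
      rw [pow_succ', mul_apply_eq_comp, hx₂, map_zSub, ← hx₁]
      simp [hint', Algebra.algebraMap_eq_smul_one, neg_add_eq_sub]
  have hv : ∀ x, ∀ a ∈ U, VanishesNear φ (Φ x) a := fun x =>
    exists_vanishesNear φ (Φ x) hU fun a ha p =>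
      (hpow a ha p x).elim fun x' hx' => ⟨Φ x', hx'⟩
  obtain ⟨ε, hε, hball⟩ := Metric.isOpen_iff.1 hU _ haU
  have hunit := isUnit_map_zSub φ hε fun f hf hts => by
    refine ContinuousLinearMap.ext fun y => ?_
    -- Each single `φ f` is bounded, so vanishing on the dense range of `Φ` is enough; continuity of
    -- `Φ` plays no role.
    refine congrFun (hΦ.equalizer (φ f).continuous continuous_const (funext fun x => ?_)) y
    exact apply_eq_zero_of_vanishesNear φ (Φ x) f hf fun a ha => hv x a (hball (hts ha))
  rw [map_zSub, hza] at hunit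
  refine hμ ?_
  rw [spectrum.mem_resolventSet_iff, ← IsUnit.neg_iff, neg_sub]
  exact hunit
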